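/- **Setting.** Clients are distributed on $[0,1]$ with a density $f$: $f\ge 0$ is integrable, $f=0$ outside $[0,1]$ and $\int f=1$. Three agents have the same width $w$, $0\le w\le 1$. Each agent $i$ chooses a location $x_i\in L=[w/2,\,1-w/2]$. The attraction interval of location $z$ is $R(z)=[z-w/2,z+w/2]$. For a profile $\vec x$ of $k$ locations let $c(y,\vec x)$ be the number of agents $i$ with $y\in R(x_i)$; the support of agent $i$ is $s_i(\vec x)=\int_{R(x_i)} f(y)/c(y,\vec x)\,dy$. In the winner-utility setting, $W$ is the set of agents with the largest support, and agent $i$ has utility $1/|W|$ if $i\in W$ and $0$ otherwise. A pure Nash equilibrium is a profile in $L^3$ at which no agent can strictly increase its own utility by moving alone to another point of $L$. **Algorithm 1.** Let $u_1=\max_{z\in L}\int_{R(z)} f(y)\,dy$. - *Case 1.* If there are three locations in $L$ such that three agents placed there simultaneously all have support $u_1$, place the agents at three such locations. - *Case 2.* Otherwise, if there are two locations in $L$ such that two agents placed there simultaneously (with no third agent) both have support $u_1$, choose two such locations, and place agent 1 at one of them and agents 2 and 3 together at the other. - Otherwise, place agent 1 at the smallest $x_1\in L$ with $\int_{R(x_1)}f(y)\,dy=u_1$.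 For $z\in L$ let $g(z)=\int_{R(z)} \frac{f(y)}{1+\mathbf 1_{R(x_1)}(y)}\,dy$, let $u_2=\max_{L} g$, and let $M=\{z\in L: g(z)=u_2\}$. - *Case 3.* If $x_1\in M$, place agents 2 and 3 at $x_1$. - *Case 4.* Otherwise, if $M$ contains points on both sides of $x_1$, put $x_2=\max\{z\in M: z<x_1\}$ and $x_3=\min\{z\in M: z>x_1\}$. - *Case 5.* Otherwise, let $t_2=\min M$ and $t_3=\max M$. If $t_2<x_1$, put $x_2=t_3$ and $x_3=t_2$; if not, put $x_2=t_2$ and $x_3=t_3$. **Theorem.** For every such $f$ and $w$, Algorithm 1 produces an output (all the maxima and minima that it uses exist), and every output $(x_1,x_2,x_3)$ of Algorithm 1, whatever choices are made in Cases 1 and 2, is a pure Nash equilibrium in the winner-utility setting. -/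

import Mathlib

open MeasureTheory

noncomputable section

namespace HotellingDowns

/-- `f` is the density of a distribution of clients on `[0, 1]`. -/
structure IsClientDensity (f : ℝ → ℝ) : Prop where
  nonneg : ∀ y, 0 ≤ f y
  eq_zero_of_notMem : ∀ y, y ∉ Set.Icc (0 : ℝ) 1 → f y = 0
  integrable : Integrable f volume
  integral_eq_one : ∫ y, f y = 1

/-- The attraction interval `[z - w/2, z + w/2]` of an agent of width `w` located at `z`. -/
def attractionInterval (w z : ℝ) : Set ℝ := Set.Icc (z - w / 2) (z + w / 2)

/-- The set `[w/2, 1 - w/2]` of admissible locations of an agent of width `w`. -/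
def locations (w : ℝ) : Set ℝ := Set.Icc (w / 2) (1 - w / 2)

open Classical in
/-- The congestion at `y`: the number of agents whose attraction interval covers `y`, where
agent `i` has width `w i` and location `x i`. -/
def congestion {n : ℕ} (w x : Fin n → ℝ) (y : ℝ) : ℕ :=
  (Finset.univ.filter fun i => y ∈ attractionInterval (w i) (x i)).card

/-- The support of agent `i`: each client in the attraction interval of `i` is shared equally
by all the agents that cover it. -/
def support (f : ℝ → ℝ) {n : ℕ} (w x : Fin n → ℝ) (i : Fin n) : ℝ :=
  ∫ y in attractionInterval (w i) (x i), f y / (congestion w x y : ℝ)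

open Classical in
/-- The winner set: the agents whose support is largest. -/
def winners (f : ℝ → ℝ) {n : ℕ} (w x : Fin n → ℝ) : Finset (Fin n) :=
  Finset.univ.filter fun i => ∀ j, support f w x j ≤ support f w x i

open Classical in
/-- The winner utility: the winners share a total utility of `1` equally. -/
def winnerUtility (f : ℝ → ℝ) {n : ℕ} (w x : Fin n → ℝ) (i : Fin n) : ℝ :=
  if i ∈ winners f w x then 1 / ((winners f w x).card : ℝ) else 0

/-- `x` is a pure Nash equilibrium of the game in which agent `i` chooses a point of `L i` and
receives utility `u x i` at the profile `x`. -/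
def IsPureNash {n : ℕ} (L : Fin n → Set ℝ) (u : (Fin n → ℝ) → Fin n → ℝ)
    (x : Fin n → ℝ) : Prop :=
  (∀ i, x i ∈ L i) ∧ ∀ i, ∀ x' ∈ L i, u (Function.update x i x') i ≤ u x i

/-- The support that one further agent of width `w` obtains at `z`, when agents of the same
width `w` are already located at the points of the profile `x`. -/
def newSupport (f : ℝ → ℝ) (w : ℝ) {k : ℕ} (x : Fin k → ℝ) (z : ℝ) : ℝ :=
  ∫ y in attractionInterval w z, f y / ((congestion (fun _ => w) x y : ℝ) + 1)

/-- `u` is the largest support that one further agent can achieve, given the profile `x`. -/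
def IsLargestSupport (f : ℝ → ℝ) (w : ℝ) {k : ℕ} (x : Fin k → ℝ) (u : ℝ) : Prop :=
  IsGreatest (newSupport f w x '' locations w) u

/-- The locations at which one further agent achieves the support `u`, given the profile `x`. -/
def achieving (f : ℝ → ℝ) (w : ℝ) {k : ℕ} (x : Fin k → ℝ) (u : ℝ) : Set ℝ :=
  {z | z ∈ locations w ∧ newSupport f w x z = u}

/-- The `k` agents located at `x`, all of width `w`, simultaneously have support `u`. -/
def AllAchieve (f : ℝ → ℝ) (w : ℝ) {k : ℕ} (u : ℝ) (x : Fin k → ℝ) : Prop :=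
  ∀ i, x i ∈ locations w ∧ support f (fun _ => w) x i = u

/-- The first phase of the algorithm when neither three nor two agents can simultaneously have
the largest support `u₁`: agent 1 goes to the leftmost location `x₁` that achieves `u₁`, and
`u₂` is the largest support that agent 2 can then achieve. -/
structure FirstPlacement (f : ℝ → ℝ) (w x₁ u₂ : ℝ) : Prop where
  exists_leftmost : ∃ u₁, IsLargestSupport f w ![] u₁ ∧
    (¬ ∃ x : Fin 3 → ℝ, AllAchieve f w u₁ x) ∧
    (¬ ∃ z : Fin 2 → ℝ, AllAchieve f w u₁ z) ∧
    IsLeast (achieving f w ![] u₁) x₁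
  largest : IsLargestSupport f w ![x₁] u₂

/-- `Algorithm1 f w x`: the profile `x = (x 0, x 1, x 2)` of the locations of agents 1, 2, 3 is a
possible output of the algorithm for the density `f` and the common width `w`. In the first two
cases the algorithm may use any locations with the required property. -/
inductive Algorithm1 (f : ℝ → ℝ) (w : ℝ) : (Fin 3 → ℝ) → Prop
  /-- Three agents can have support `u₁` simultaneously. -/
  | case1 (u₁ : ℝ) (x : Fin 3 → ℝ) (hu : IsLargestSupport f w ![] u₁)
      (hx : AllAchieve f w u₁ x) : Algorithm1 f w x
  /-- Only two agents can have support `u₁` simultaneously. -/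
  | case2 (u₁ : ℝ) (z : Fin 2 → ℝ) (hu : IsLargestSupport f w ![] u₁)
      (hthree : ¬ ∃ x : Fin 3 → ℝ, AllAchieve f w u₁ x)
      (hz : AllAchieve f w u₁ z) : Algorithm1 f w ![z 0, z 1, z 1]
  /-- Agent 2 achieves `u₂` at `x₁`. -/
  | case3 (x₁ u₂ : ℝ) (h : FirstPlacement f w x₁ u₂)
      (hmem : x₁ ∈ achieving f w ![x₁] u₂) : Algorithm1 f w ![x₁, x₁, x₁]
  /-- Agent 2 achieves `u₂` on both sides of `x₁`, but not at `x₁`. -/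
  | case4 (x₁ u₂ x₂ x₃ : ℝ) (h : FirstPlacement f w x₁ u₂)
      (hnot : x₁ ∉ achieving f w ![x₁] u₂)
      (h₂ : IsGreatest {z | z ∈ achieving f w ![x₁] u₂ ∧ z < x₁} x₂)
      (h₃ : IsLeast {z | z ∈ achieving f w ![x₁] u₂ ∧ x₁ < z} x₃) :
      Algorithm1 f w ![x₁, x₂, x₃]
  /-- Agent 2 achieves `u₂` on exactly one side of `x₁`, and not at `x₁`. -/
  | case5 (x₁ u₂ t₂ t₃ : ℝ) (h : FirstPlacement f w x₁ u₂)
      (hnot : x₁ ∉ achieving f w ![x₁] u₂)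
      (hside : ¬ ((∃ z ∈ achieving f w ![x₁] u₂, z < x₁) ∧
        ∃ z ∈ achieving f w ![x₁] u₂, x₁ < z))
      (h₂ : IsLeast (achieving f w ![x₁] u₂) t₂)
      (h₃ : IsGreatest (achieving f w ![x₁] u₂) t₃) :
      Algorithm1 f w (if t₂ < x₁ then ![x₁, t₃, t₂] else ![x₁, t₂, t₃])

end HotellingDowns

end

noncomputable section

namespace HotellingDowns

/-! Splitting the clients of an interval by how often they are covered expresses supports by masses,
pairwise overlaps and the triple overlap. All widths are equal, so the triple overlap is that of the
two outer intervals, and the game reduces to inequalities between values of two monotone functions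
`A` and `B`.

The main observation: with the leader at `x₁`, the supports of agents at `t` and `z` differ by
exactly `g t - g z`, because their mutual overlap and the triple overlap cost both the same. So
against a leader and a follower in `M`, a deviating follower can win only from a point of `M`, where
it ties with the other follower. Only the comparison with the leader remains.

In Cases 1 and 2 support `u₁` forces full mass and null overlaps, so a deviator never overtakes the
agents that stay. In Case 3, `g x₁ = u₁ / 2` is the maximum of `g`, and the same difference formula
applies.

In Cases 4 and 5, `x₁ ∉ M` gives `u₂ > u₁ / 2`, so no point of `M` has overlap `u₁` with the leader.
This excludes degenerate ties: they would force values of `A` or `B` to coincide and such an overlap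
to appear. In Case 4 (`stable_outer`, `stable_inner`) the followers are the points of `M` nearest to
`x₁`; other points of `M` on the same side harm the leader relatively less. In Case 5
(`stable_right_leader`, `stable_right_near`, `stable_right_far`) the extremes of `M` keep the
followers' mutual overlap small. The leftmost choice of `x₁` settles the remaining ties for the
leader. -/

/-- The mass of the interval at `z`, where `A z` and `B z` are the values of the distribution
function at its right and left end. -/
def mass (A B : ℝ → ℝ) (z : ℝ) : ℝ := A z - B z

/-- The mass of the overlap of the intervals at `x` and `y`. -/
def overlap (A B : ℝ → ℝ) (x y : ℝ) : ℝ := max 0 (A (min x y) - B (max x y))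

/-- The mass of the common part of the intervals at `x`, `y` and `z`. -/
def overlap₃ (A B : ℝ → ℝ) (x y z : ℝ) : ℝ :=
  max 0 (A (min x (min y z)) - B (max x (max y z)))

/-- The support at `x` when the other two agents are at `y` and `z`. -/
def share (A B : ℝ → ℝ) (x y z : ℝ) : ℝ :=
  mass A B x - overlap A B x y / 2 - overlap A B x z / 2 + overlap₃ A B x y z / 3

open Classical in
/-- The winner utility of an agent of support `p` against two agents of supports `q` and `r`. -/
def payoff (p q r : ℝ) : ℝ :=
  if p < q ∨ p < r then 0 else if p = q ∧ p = r then 1 / 3 else if p = q ∨ p = r then 1 / 2 else 1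

/-- The utility of an agent at `x` when the other two agents are at `y` and `z`. -/
def gain (A B : ℝ → ℝ) (x y z : ℝ) : ℝ :=
  payoff (share A B x y z) (share A B y x z) (share A B z x y)

/-- The agent at `x` has no profitable deviation against agents at `y` and `z`. -/
def Stable (A B : ℝ → ℝ) (L : Set ℝ) (x y z : ℝ) : Prop :=
  ∀ x' ∈ L, gain A B x' y z ≤ gain A B x y z

/-! ### Winner utility among three supports -/

lemma payoff_nonneg (p q r : ℝ) : 0 ≤ payoff p q r := by
  unfold payoff; split_ifs <;> norm_num

lemma payoff_le_one (p q r : ℝ) : payoff p q r ≤ 1 := by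
  unfold payoff; split_ifs <;> norm_num

lemma payoff_comm (p q r : ℝ) : payoff p q r = payoff p r q := by
  simp only [payoff, or_comm, and_comm]

lemma payoff_eq_one {p q r : ℝ} (h₁ : q < p) (h₂ : r < p) : payoff p q r = 1 := by
  simp [payoff, h₁.le, h₂.le, h₁.ne', h₂.ne']

lemma third_le_payoff {p q r : ℝ} (h₁ : q ≤ p) (h₂ : r ≤ p) : 1 / 3 ≤ payoff p q r := by
  unfold payoff
  rw [if_neg (by simp [h₁, h₂])]
  split_ifs <;> norm_num

lemma half_le_payoff {p q r : ℝ} (h₁ : q ≤ p) (h₂ : r < p) : 1 / 2 ≤ payoff p q r := by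
  unfold payoff
  rw [if_neg (by simp [h₁, h₂.le]), if_neg (by simp [h₂.ne'])]
  split_ifs <;> norm_num

lemma payoff_le_third {p q r : ℝ} (h₁ : p ≤ q) (h₂ : p ≤ r) : payoff p q r ≤ 1 / 3 := by
  unfold payoff
  split_ifs with h h' h''
  · norm_num
  · norm_num
  all_goals
    exact absurd ⟨h₁.antisymm (not_lt.1 fun k => h (.inl k)),
      h₂.antisymm (not_lt.1 fun k => h (.inr k))⟩ h'

lemma payoff_le_half {p q r : ℝ} (h₁ : p ≤ q) : payoff p q r ≤ 1 / 2 := by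
  unfold payoff
  split_ifs with h _ h'
  · norm_num
  · norm_num
  · norm_num
  · exact absurd (.inl (h₁.antisymm (not_lt.1 fun k => h (.inl k)))) h'

/-- A loser receives 0, so a deviation may be assumed to win; this supplies the two inequalities
that every stability proof exploits. -/
lemma payoff_le_of_winning {p q r v : ℝ} (hv : 0 ≤ v)
    (h : q ≤ p → r ≤ p → payoff p q r ≤ v) : payoff p q r ≤ v := by
  by_cases h₁ : q ≤ p
  · by_cases h₂ : r ≤ p
    · exact h h₁ h₂
    · simpa [payoff, not_le.1 h₂] using hv
  · simpa [payoff, not_le.1 h₁] using hv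

lemma gain_nonneg (A B : ℝ → ℝ) (x y z : ℝ) : 0 ≤ gain A B x y z := payoff_nonneg _ _ _

/-! ### Overlaps and supports of equally wide intervals -/

section Overlap

variable {A B : ℝ → ℝ}

lemma overlap_comm (A B : ℝ → ℝ) (x y : ℝ) : overlap A B x y = overlap A B y x := by
  simp only [overlap, min_comm, max_comm]

lemma overlap_nonneg (A B : ℝ → ℝ) (x y : ℝ) : 0 ≤ overlap A B x y := le_max_left _ _

lemma overlap₃_nonneg (A B : ℝ → ℝ) (x y z : ℝ) : 0 ≤ overlap₃ A B x y z := le_max_left _ _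

lemma share_comm (A B : ℝ → ℝ) (x y z : ℝ) : share A B x y z = share A B x z y := by
  simp only [share, overlap₃, min_comm y z, max_comm y z]; ring

lemma overlap_of_le {x y : ℝ} (h : x ≤ y) : overlap A B x y = max 0 (A x - B y) := by
  simp [overlap, h]

/-- Removes the truncation at 0, so that coincidences between overlaps become equalities between
values of `A` or `B`. -/
lemma overlap_of_pos {x y : ℝ} (h : x ≤ y) (hp : 0 < overlap A B x y) :
    overlap A B x y = A x - B y := by
  rw [overlap_of_le h] at *
  exact max_eq_right (le_of_lt (by simpa using hp))

lemma sub_le_overlap {x y : ℝ} (h : x ≤ y) : A x - B y ≤ overlap A B x y := by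
  rw [overlap_of_le h]; exact le_max_right _ _

lemma overlap_self (hAB : ∀ t, B t ≤ A t) (x : ℝ) : overlap A B x x = mass A B x := by
  simp [overlap, mass, hAB]

lemma overlap_le_left (hB : Monotone B) {x y z : ℝ} (hxy : x ≤ y) (hyz : y ≤ z) :
    overlap A B x z ≤ overlap A B x y := by
  rw [overlap_of_le hxy, overlap_of_le (hxy.trans hyz)]
  exact max_le_max le_rfl (by linarith [hB hyz])

lemma overlap_le_right (hA : Monotone A) {x y z : ℝ} (hxy : x ≤ y) (hyz : y ≤ z) :
    overlap A B x z ≤ overlap A B y z := by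
  rw [overlap_of_le hyz, overlap_of_le (hxy.trans hyz)]
  exact max_le_max le_rfl (by linarith [hA hxy])

/-- The positive part is convex: lowering its argument by `B s - B r` costs more at the larger value
`A q` than at `A p`. -/
lemma overlap_sub_le (hA : Monotone A) (hB : Monotone B) {p q r s : ℝ} (hpq : p ≤ q)
    (hqr : q ≤ r) (hrs : r ≤ s) :
    overlap A B p r - overlap A B p s ≤ overlap A B q r - overlap A B q s := by
  rw [overlap_of_le (hpq.trans hqr), overlap_of_le (hpq.trans (hqr.trans hrs)),
    overlap_of_le hqr, overlap_of_le (hqr.trans hrs)]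
  have := hA hpq
  have := hB hrs
  rcases max_cases 0 (A p - B r) with h | h <;> rcases max_cases 0 (A p - B s) with h' | h' <;>
    rcases max_cases 0 (A q - B r) with k | k <;> rcases max_cases 0 (A q - B s) with k' | k' <;>
    linarith

lemma overlap₃_le (hA : Monotone A) (hB : Monotone B) (x y z : ℝ) :
    overlap₃ A B x y z ≤ overlap A B x y ∧ overlap₃ A B x y z ≤ overlap A B x z ∧
      overlap₃ A B x y z ≤ overlap A B y z := by
  refine ⟨?_, ?_, ?_⟩ <;> refine max_le_max le_rfl (sub_le_sub (hA ?_) (hB ?_)) <;> grind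

lemma overlap₃_rotate (A B : ℝ → ℝ) (x y z : ℝ) : overlap₃ A B x y z = overlap₃ A B y x z := by
  simp only [overlap₃, min_left_comm x y z, max_left_comm x y z]

/-- With equal widths the middle interval contains the intersection of the outer two. -/
lemma overlap₃_of_le {x y z : ℝ} (hxy : x ≤ y) (hyz : y ≤ z) :
    overlap₃ A B x y z = overlap A B x z := by
  simp [overlap₃, overlap, hxy, hyz, hxy.trans hyz]

lemma share_left {x y z : ℝ} (hxy : x ≤ y) (hyz : y ≤ z) :
    share A B x y z = mass A B x - overlap A B x y / 2 - overlap A B x z / 6 := by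
  rw [share, overlap₃_of_le hxy hyz]; ring

lemma share_middle {x y z : ℝ} (hxy : x ≤ y) (hyz : y ≤ z) :
    share A B y x z =
      mass A B y - overlap A B x y / 2 - overlap A B y z / 2 + overlap A B x z / 3 := by
  rw [share, overlap₃_rotate, overlap₃_of_le hxy hyz, overlap_comm A B y x]

lemma share_right {x y z : ℝ} (hxy : x ≤ y) (hyz : y ≤ z) :
    share A B z x y = mass A B z - overlap A B y z / 2 - overlap A B x z / 6 := by
  have h : overlap₃ A B z x y = overlap₃ A B x y z := by
    rw [overlap₃_rotate]; simp only [overlap₃, min_comm z y, max_comm z y]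
  rw [share, h, overlap₃_of_le hxy hyz, overlap_comm A B z x,
    overlap_comm A B z y]; ring

end Overlap

/-! ### Equilibria of Cases 1 to 3 -/

section Stability

variable {A B : ℝ → ℝ} {L : Set ℝ}

lemma gain_left {x y z : ℝ} (hxy : x ≤ y) (hyz : y ≤ z) :
    gain A B x y z = payoff
      (mass A B x - overlap A B x y / 2 - overlap A B x z / 6)
      (mass A B y - overlap A B x y / 2 - overlap A B y z / 2 + overlap A B x z / 3)
      (mass A B z - overlap A B y z / 2 - overlap A B x z / 6) := by
  rw [gain, share_left hxy hyz, share_middle hxy hyz, share_right hxy hyz]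

lemma gain_middle {x y z : ℝ} (hxy : x ≤ y) (hyz : y ≤ z) :
    gain A B y x z = payoff
      (mass A B y - overlap A B x y / 2 - overlap A B y z / 2 + overlap A B x z / 3)
      (mass A B x - overlap A B x y / 2 - overlap A B x z / 6)
      (mass A B z - overlap A B y z / 2 - overlap A B x z / 6) := by
  rw [gain, share_comm A B z, share_left hxy hyz, share_middle hxy hyz, share_right hxy hyz]

lemma gain_right {x y z : ℝ} (hxy : x ≤ y) (hyz : y ≤ z) :
    gain A B z x y = payoff
      (mass A B z - overlap A B y z / 2 - overlap A B x z / 6)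
      (mass A B x - overlap A B x y / 2 - overlap A B x z / 6)
      (mass A B y - overlap A B x y / 2 - overlap A B y z / 2 + overlap A B x z / 3) := by
  rw [gain, share_comm A B x, share_comm A B y, share_left hxy hyz, share_middle hxy hyz,
    share_right hxy hyz]

/-- `x₁` attains the largest mass `u₁`, and `u₂ > u₁ / 2` bounds the support of a second agent. -/
structure Leader (A B : ℝ → ℝ) (L : Set ℝ) (u₁ u₂ x₁ : ℝ) : Prop where
  monoA : Monotone A
  monoB : Monotone B
  le : ∀ t, B t ≤ A t
  mass_le : ∀ z ∈ L, mass A B z ≤ u₁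
  mass_eq : mass A B x₁ = u₁
  second_le : ∀ z ∈ L, mass A B z - overlap A B x₁ z / 2 ≤ u₂
  half_lt : u₁ / 2 < u₂

/-- Three agents of support `u` form an equilibrium, if `u` is the largest mass. -/
lemma stable_of_disjoint (hA : Monotone A) (hB : Monotone B) {x y z u : ℝ}
    (hL : ∀ t ∈ L, mass A B t ≤ u) (hx : share A B x y z = u) (hy : share A B y x z = u)
    (hz : share A B z x y = u) (hym : mass A B y ≤ u)
    (hzm : mass A B z ≤ u) : Stable A B L x y z := by
  -- The triple overlap is at most each pairwise one, so an agent loses at least a third of the sum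
  -- of its two overlaps; support `u` leaves nothing to lose.
  have key : ∀ p q r : ℝ, mass A B p ≤ u → share A B p q r = u →
      mass A B p = u ∧ overlap A B p q = 0 := by
    intro p q r hm hs
    rw [share] at hs
    have := overlap₃_le hA hB p q r
    have := overlap_nonneg A B p q
    have := overlap_nonneg A B p r
    constructor <;> linarith
  obtain ⟨hy', -⟩ := key y x z hym hy
  obtain ⟨hz', -⟩ := key z x y hzm hz
  obtain ⟨-, hyz⟩ := key y z x hym (share_comm A B y x z ▸ hy)
  intro x' hx'
  have h1 : 1 / 3 ≤ gain A B x y z := third_le_payoff (by rw [hx, hy]) (by rw [hx, hz])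
  refine le_trans (payoff_le_third ?_ ?_) h1
  all_goals
    simp only [share]
    have := overlap₃_le hA hB x' y z
    have := overlap₃_nonneg A B x' y z
    have := hL x' hx'
    have := overlap_nonneg A B x' y
    have := overlap_nonneg A B x' z
    have := overlap_comm A B x' y
    have := overlap_comm A B x' z
    have := overlap_comm A B z y
    have := overlap₃_le hA hB y x' z
    have := overlap₃_le hA hB z x' y
    have := overlap₃_nonneg A B y x' z
    have := overlap₃_nonneg A B z x' y
    linarith

/-- If a third agent cannot have support `u` beside `x` and `y`, the two agents at `y` are
stable. -/
lemma stable_of_pair (hA : Monotone A) (hB : Monotone B) {x y u : ℝ}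
    (hL : ∀ t ∈ L, mass A B t ≤ u) (hx : mass A B x = u) (hy : mass A B y = u)
    (hxy : overlap A B x y = 0)
    (hthree : ∀ t ∈ L, ¬ (mass A B t = u ∧ overlap A B t x = 0 ∧ overlap A B t y = 0)) :
    Stable A B L y x y := by
  intro t ht
  refine payoff_le_of_winning (gain_nonneg _ _ _ _ _) fun h₁ h₂ => ?_
  exfalso
  simp only [share] at h₁ h₂
  have := overlap₃_le hA hB t x y
  have := overlap₃_nonneg A B t x y
  have := hL t ht
  have := overlap_nonneg A B t x
  have := overlap_nonneg A B t y
  have := overlap_comm A B t x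
  have := overlap_comm A B t y
  have := overlap_comm A B y x
  have := overlap₃_le hA hB x t y
  have := overlap₃_le hA hB y t x
  have := overlap₃_nonneg A B x t y
  have := overlap₃_nonneg A B y t x
  exact hthree t ht ⟨by linarith, by linarith, by linarith⟩

/-- The agent facing two agents that stand together at a disjoint location wins alone. -/
lemma stable_of_sole (hAB : ∀ t, B t ≤ A t) {x y u : ℝ} (hu : 0 < u)
    (hx : mass A B x = u) (hy : mass A B y = u) (hxy : overlap A B x y = 0) :
    Stable A B L x y y := by
  intro t _
  have h₃ : overlap₃ A B x y y = overlap A B x y := by simp [overlap₃, overlap]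
  have h₄ : overlap₃ A B y x y = overlap A B x y := by rw [overlap₃_rotate, h₃]
  refine (payoff_le_one _ _ _).trans (payoff_eq_one ?_ ?_).ge <;>
  · simp only [share, h₃, h₄, overlap_comm A B y x, overlap_self hAB, hxy, hx, hy]
    linarith

/-- Three agents at a location `x` which is a best second location beside `x` are stable. -/
lemma stable_of_common (hAB : ∀ t, B t ≤ A t) {x : ℝ}
    (hL : ∀ t ∈ L, mass A B t - overlap A B x t / 2 ≤ mass A B x / 2) :
    Stable A B L x x x := by
  intro t ht
  have h₃ : overlap₃ A B t x x = overlap A B x t := by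
    rw [overlap_comm A B x t]; simp [overlap₃, overlap]
  have h₄ : overlap₃ A B x t x = overlap A B x t := by rw [overlap₃_rotate, h₃]
  refine le_trans (payoff_le_third ?_ ?_) (third_le_payoff le_rfl le_rfl) <;>
  · simp only [share, h₃, h₄, overlap_comm A B t x, overlap_self hAB]
    linarith [hL t ht]

namespace Leader

variable {u₁ u₂ x₁ : ℝ} (h : Leader A B L u₁ u₂ x₁)

end Leader

end Stability

/-! ### Equilibria of Cases 4 and 5, with a leader and two followers -/

namespace Leader

variable {A B : ℝ → ℝ} {L : Set ℝ} {u₁ u₂ x₁ x₂ x₃ : ℝ}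

/-- A winning deviation left of `x₁` lies in `M`, hence at or beyond `x₂`, where by `overlap_sub_le`
its margin over the leader is no larger. Between `x₁` and `x₃` it would contradict the choice of
`x₃`. Beyond `x₃` it does not exceed the agent at `x₃`. -/
lemma stable_outer (h : Leader A B L u₁ u₂ x₁) (h₂₁ : x₂ < x₁) (h₁₃ : x₁ < x₃)
    (hL₃ : x₃ ∈ L)
    (e₂ : mass A B x₂ - overlap A B x₁ x₂ / 2 = u₂)
    (e₃ : mass A B x₃ - overlap A B x₁ x₃ / 2 = u₂)
    (max₂ : ∀ z ∈ L, x₂ < z → z ≤ x₁ → mass A B z - overlap A B x₁ z / 2 < u₂)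
    (min₃ : ∀ z ∈ L, x₁ ≤ z → z < x₃ → mass A B z - overlap A B x₁ z / 2 < u₂) :
    Stable A B L x₂ x₁ x₃ := by
  intro t ht
  have hm₁ := h.mass_eq
  have hm₃ := h.mass_le x₃ hL₃
  have hmt := h.mass_le t ht
  have hgt := h.second_le t ht
  have hhalf := h.half_lt
  rw [overlap_comm A B x₁ x₂] at e₂
  have hac := overlap_le_left (A := A) h.monoB h₂₁.le h₁₃.le
  have hbc := overlap_le_right (B := B) h.monoA h₂₁.le h₁₃.le
  rcases le_total t x₁ with hle | hle
  · rw [gain_left hle h₁₃.le, gain_left h₂₁.le h₁₃.le]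
    rw [overlap_comm A B x₁ t] at hgt
    refine payoff_le_of_winning (payoff_nonneg _ _ _) fun w₁ w₂ => ?_
    have hg : mass A B t - overlap A B t x₁ / 2 = u₂ := by linarith
    have ht₂ : t ≤ x₂ := by
      by_contra! hlt
      have := max₂ t ht hlt hle
      rw [overlap_comm A B x₁ t] at this
      linarith
    have := overlap_sub_le h.monoA h.monoB ht₂ h₂₁.le h₁₃.le
    rcases w₁.lt_or_eq with w | w
    · exact ((payoff_comm _ _ _).trans_le (payoff_le_half (by linarith))).trans
        ((payoff_comm _ _ _).trans_ge (half_le_payoff (by linarith) (by linarith)))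
    · exact (payoff_le_third w.ge (by linarith)).trans
        (third_le_payoff (by linarith) (by linarith))
  rcases lt_or_ge t x₃ with hlt | hge
  · rw [gain_middle hle hlt.le]
    refine payoff_le_of_winning (gain_nonneg _ _ _ _ _) fun w₁ w₂ => ?_
    have := min₃ t ht hle hlt
    linarith
  · rw [gain_right h₁₃.le hge, gain_left h₂₁.le h₁₃.le]
    have ha' := overlap_le_right (B := B) h.monoA h₁₃.le hge
    have hb' := overlap_le_left (A := A) h.monoB h₁₃.le hge
    refine payoff_le_of_winning (payoff_nonneg _ _ _) fun w₁ w₂ => ?_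
    rcases hac.lt_or_eq with hlt | heq
    · exact (payoff_le_half (by linarith)).trans
        ((payoff_comm _ _ _).trans_ge (half_le_payoff (by linarith) (by linarith)))
    rcases (overlap_nonneg A B x₂ x₃).eq_or_lt with hc | hc
    · exact (payoff_le_third (by linarith) (by linarith)).trans
        (third_le_payoff (by linarith) (by linarith))
    -- Equal positive overlaps give `B x₁ = B x₃`, so `x₃` overlaps the leader in mass `u₁` and `u₂
    -- ≤ u₁ / 2`.
    · exfalso
      have k₁ := overlap_of_pos (h₂₁.trans h₁₃).le hc
      have k₂ := overlap_of_pos h₂₁.le (by linarith)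
      have k₃ := overlap_of_pos h₁₃.le (by linarith)
      simp only [mass] at *
      linarith

/-- Both followers have support `u₂ - overlap A B x₂ x₃ / 6`. If the leader does not win alone, it
takes near-equalities for a deviation to win, and `mass A B x₂ < u₁`, which holds as `x₁` is
leftmost, excludes most of them. -/
lemma stable_inner (h : Leader A B L u₁ u₂ x₁) (h₂₁ : x₂ < x₁) (h₁₃ : x₁ < x₃)
    (hL₂ : x₂ ∈ L) (hL₃ : x₃ ∈ L)
    (e₂ : mass A B x₂ - overlap A B x₁ x₂ / 2 = u₂)
    (e₃ : mass A B x₃ - overlap A B x₁ x₃ / 2 = u₂)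
    (max₂ : ∀ z ∈ L, x₂ < z → z ≤ x₁ → mass A B z - overlap A B x₁ z / 2 < u₂)
    (min₃ : ∀ z ∈ L, x₁ ≤ z → z < x₃ → mass A B z - overlap A B x₁ z / 2 < u₂)
    (hleft : ∀ z ∈ L, mass A B z = u₁ → x₁ ≤ z) :
    Stable A B L x₁ x₂ x₃ := by
  intro t ht
  have hm₁ := h.mass_eq
  have hm₃ := h.mass_le x₃ hL₃
  have hmt := h.mass_le t ht
  have hgt := h.second_le t ht
  have hhalf := h.half_lt
  have hm₂ : mass A B x₂ < u₁ :=
    (h.mass_le x₂ hL₂).lt_of_ne fun k => (hleft x₂ hL₂ k).not_gt h₂₁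
  have hmt' : t < x₁ → mass A B t < u₁ := fun hlt =>
    hmt.lt_of_ne fun k => (hleft t ht k).not_gt hlt
  rw [overlap_comm A B x₁ x₂] at e₂
  have hac := overlap_le_left (A := A) h.monoB h₂₁.le h₁₃.le
  have hbc := overlap_le_right (B := B) h.monoA h₂₁.le h₁₃.le
  have h₂₃ := h₂₁.trans h₁₃
  rw [gain_middle h₂₁.le h₁₃.le]
  by_cases hsole : u₂ - overlap A B x₂ x₃ / 6 < mass A B x₁ - overlap A B x₂ x₁ / 2 -
      overlap A B x₁ x₃ / 2 + overlap A B x₂ x₃ / 3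
  · exact (payoff_le_one _ _ _).trans (payoff_eq_one (by linarith) (by linarith)).ge
  have hc₀ := overlap_nonneg A B x₂ x₃
  rcases le_or_gt t x₂ with hle | hgt₂
  · rw [gain_left hle h₂₃.le]
    have := overlap_le_left (A := A) h.monoB hle h₂₁.le
    rw [overlap_comm A B x₁ t] at hgt
    refine payoff_le_of_winning (payoff_nonneg _ _ _) fun w₁ w₂ => ?_
    linarith
  rcases le_or_gt x₃ t with hge | hlt₃
  · rw [gain_right h₂₃.le hge]
    have k₁ := overlap_le_right (B := B) h.monoA h₁₃.le hge
    have k₂ := overlap_le_left (A := A) h.monoB h₁₃.le hge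
    refine payoff_le_of_winning (payoff_nonneg _ _ _) fun w₁ w₂ => ?_
    -- Winning forces the overlaps of `x₂` with `x₁` and with `x₃` to agree. Were they positive, `B
    -- x₁ = B x₃` and `x₃` would overlap the leader in mass `u₁`.
    have hc : overlap A B x₂ x₃ = 0 := by
      by_contra hne
      have hpos : 0 < overlap A B x₂ x₃ := hc₀.lt_of_ne' hne
      have k₁ := overlap_of_pos h₂₃.le hpos
      have k₂ := overlap_of_pos h₂₁.le (by linarith)
      have k₃ := overlap_of_pos h₁₃.le (by linarith)
      simp only [mass] at *
      linarith
    have := overlap_le_left (A := A) h.monoB h₂₃.le hge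
    have := overlap_nonneg A B x₂ t
    exact (payoff_le_third (by linarith) (by linarith)).trans
        (third_le_payoff (by linarith) (by linarith))
  rw [gain_middle hgt₂.le hlt₃.le]
  refine payoff_le_of_winning (payoff_nonneg _ _ _) fun w₁ w₂ => ?_
  rcases hc₀.eq_or_lt with hc | hc
  · rcases lt_or_ge t x₁ with hlt | hge
    · have := overlap_le_left (A := A) h.monoB hgt₂.le hlt.le
      have := hmt' hlt
      linarith
    · have k₁ := overlap_le_right (B := B) h.monoA hge hlt₃.le
      have k₂ := min₃ t ht hge hlt₃
      have hw : mass A B t - overlap A B x₂ t / 2 - overlap A B t x₃ / 2 +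
          overlap A B x₂ x₃ / 3 ≤ mass A B x₃ - overlap A B t x₃ / 2 -
          overlap A B x₂ x₃ / 6 := by
        by_contra! hw
        have k₃ := overlap_nonneg A B x₂ t
        have k₄ : overlap A B x₂ x₁ = A x₂ - B x₁ := overlap_of_pos h₂₁.le (by linarith)
        rcases (overlap_nonneg A B x₁ x₃).eq_or_lt with hb | hb
        · linarith
        -- Here `t` has mass `u₁` and the same overlap with `x₃` as `x₁`, so `A t = A x₁` and `B t =
        -- B x₁`; then `t` overlaps `x₂` as much as `x₁` does, against `hw`.
        · have k₅ := overlap_of_pos h₁₃.le hb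
          have k₆ := overlap_of_pos hlt₃.le (by linarith)
          have := sub_le_overlap (A := A) (B := B) hgt₂.le
          simp only [mass] at *
          linarith
      exact (payoff_le_third (by linarith) (by linarith)).trans
        (third_le_payoff (by linarith) (by linarith))
  -- All intervals now overlap and everything is linear. Left of `x₁`, matching `x₂` means `A t - 2
  -- * B t ≥ A x₂ - 2 * B x₂`, the reverse of `max₂`; right of `x₁`, `x₃` and `min₃` play these
  -- roles.
  · exfalso
    have k₁ := overlap_of_pos h₂₃.le hc
    have k₂ := overlap_of_pos h₂₁.le (by linarith)
    have k₃ := overlap_of_pos h₁₃.le (by linarith)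
    have k₄ := overlap_le_left (A := A) h.monoB hgt₂.le hlt₃.le
    have k₅ := overlap_le_right (B := B) h.monoA hgt₂.le hlt₃.le
    have k₆ := overlap_of_pos hgt₂.le (by linarith)
    have k₇ := overlap_of_pos hlt₃.le (by linarith)
    rcases le_total t x₁ with hle | hge
    · have k₈ := max₂ t ht hgt₂ hle
      have k₉ := overlap_of_pos hle (by linarith [overlap_le_right (B := B) h.monoA hgt₂.le hle])
      rw [overlap_comm A B x₁ t] at k₈
      simp only [mass] at *
      linarith
    · have k₈ := min₃ t ht hge hlt₃
      have k₉ := overlap_of_pos hge (by linarith [overlap_le_left (A := A) h.monoB hge hlt₃.le])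
      simp only [mass] at *
      linarith

/-- The leader wins alone unless `x₂` also has mass `u₁`, and only then does its leftmost position
matter. Making `hleft` conditional lets the reflected situation use the lemma, where `x₁` becomes
rightmost. -/
lemma stable_right_leader (h : Leader A B L u₁ u₂ x₁) (h₁₂ : x₁ < x₂) (h₂₃ : x₂ ≤ x₃)
    (hL₂ : x₂ ∈ L)
    (e₂ : mass A B x₂ - overlap A B x₁ x₂ / 2 = u₂)
    (e₃ : mass A B x₃ - overlap A B x₁ x₃ / 2 = u₂)
    (hleft : mass A B x₂ = u₁ → ∀ z ∈ L, mass A B z = u₁ → x₁ ≤ z) :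
    Stable A B L x₁ x₂ x₃ := by
  intro t ht
  have hm₁ := h.mass_eq
  have hm₂ := h.mass_le x₂ hL₂
  have hmt := h.mass_le t ht
  have hgt := h.second_le t ht
  have hhalf := h.half_lt
  have hab := overlap_le_left (A := A) h.monoB h₁₂.le h₂₃
  have hcb := overlap_le_right (B := B) h.monoA h₁₂.le h₂₃
  rw [gain_left h₁₂.le h₂₃]
  by_cases hsole : mass A B x₂ = u₁ ∧ overlap A B x₁ x₃ = overlap A B x₂ x₃
  swap
  · have : mass A B x₂ < u₁ ∨ overlap A B x₁ x₃ < overlap A B x₂ x₃ := by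
      by_contra! hn
      exact hsole ⟨hm₂.antisymm hn.1, hcb.antisymm hn.2⟩
    refine (payoff_le_one _ _ _).trans (payoff_eq_one ?_ ?_).ge <;>
      rcases this with k | k <;> linarith
  obtain ⟨hm₂', hbc⟩ := hsole
  -- Otherwise `A x₁ = A x₂`, so `x₁` and `x₂` overlap in mass `u₁` and `u₂ = u₁ / 2`.
  have hb : overlap A B x₁ x₃ = 0 := by
    by_contra hne
    have hpos : 0 < overlap A B x₁ x₃ := (overlap_nonneg A B x₁ x₃).lt_of_ne' hne
    have k₁ := overlap_of_pos (h₁₂.le.trans h₂₃) hpos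
    have k₂ := overlap_of_pos h₁₂.le (by linarith)
    have k₃ := overlap_of_pos h₂₃ (by linarith)
    simp only [mass] at *
    linarith
  refine le_trans ?_ (third_le_payoff (by linarith) (by linarith))
  refine payoff_le_of_winning (by norm_num) fun w₁ w₂ => ?_
  -- Being leftmost puts `x₁` at or before `t`. For `t` beyond `x₂` the bound comes from `g t ≤ u₂`,
  -- which makes `t` overlap `x₁` at least as much as `x₂` does.
  have key : mass A B t = u₁ → overlap A B x₂ x₁ ≤ overlap A B t x₂ := by
    intro k
    rw [overlap_comm A B x₂ x₁]
    have := hleft hm₂' t ht k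
    rcases le_total t x₂ with hle | hge
    · exact overlap_le_right h.monoA this hle
    · rw [overlap_comm A B t x₂]
      have := overlap_le_right (B := B) h.monoA h₁₂.le hge
      linarith
  refine payoff_le_third ?_ ?_ <;> simp only [share] at w₁ w₂ ⊢ <;>
  · have := overlap₃_le h.monoA h.monoB t x₂ x₃
    have := overlap₃_nonneg A B t x₂ x₃
    have := overlap_nonneg A B t x₂
    have := overlap_nonneg A B t x₃
    have := overlap₃_le h.monoA h.monoB x₂ t x₃
    have := overlap₃_nonneg A B x₂ t x₃
    have := overlap₃_le h.monoA h.monoB x₃ t x₂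
    have := overlap₃_nonneg A B x₃ t x₂
    have := overlap_comm A B x₂ x₁
    have := overlap_comm A B x₂ t
    have := overlap_comm A B x₃ t
    have := overlap_comm A B x₃ x₂
    have := key (by linarith)
    linarith

/-- A winning deviation lies in `M`, hence between `x₂` and `x₃`. There it takes no more from the
leader and overlaps `x₃` no less than the agent at `x₂`, and it never exceeds the leader. -/
lemma stable_right_near (h : Leader A B L u₁ u₂ x₁) (h₁₂ : x₁ < x₂) (h₂₃ : x₂ ≤ x₃)
    (hL₂ : x₂ ∈ L)
    (e₂ : mass A B x₂ - overlap A B x₁ x₂ / 2 = u₂)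
    (e₃ : mass A B x₃ - overlap A B x₁ x₃ / 2 = u₂)
    (hM : ∀ z ∈ L, mass A B z - overlap A B x₁ z / 2 = u₂ → x₂ ≤ z ∧ z ≤ x₃) :
    Stable A B L x₂ x₁ x₃ := by
  intro t ht
  have hm₁ := h.mass_eq
  have hm₂ := h.mass_le x₂ hL₂
  have hmt := h.mass_le t ht
  have hgt := h.second_le t ht
  have hab := overlap_le_left (A := A) h.monoB h₁₂.le h₂₃
  have hcb := overlap_le_right (B := B) h.monoA h₁₂.le h₂₃
  have h₁₃ := h₁₂.le.trans h₂₃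
  rw [gain_middle h₁₂.le h₂₃]
  rcases le_or_gt t x₁ with hle | hlt
  · rw [gain_left hle h₁₃]
    refine payoff_le_of_winning (payoff_nonneg _ _ _) fun w₁ w₂ => ?_
    rw [overlap_comm A B x₁ t] at hgt
    have := hM t ht (by rw [overlap_comm A B x₁ t]; linarith)
    linarith
  rcases le_or_gt t x₃ with hle | hlt₃
  · rw [gain_middle hlt.le hle]
    refine payoff_le_of_winning (payoff_nonneg _ _ _) fun w₁ w₂ => ?_
    have hcb' := overlap_le_right (B := B) h.monoA hlt.le hle
    have := hM t ht (by linarith)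
    have k₁ := overlap_le_left (A := A) h.monoB h₁₂.le this.1
    have k₂ := overlap_le_right (B := B) h.monoA this.1 hle
    exact (payoff_le_third (by linarith) (by linarith)).trans
      (third_le_payoff (by linarith) (by linarith))
  · rw [gain_right h₁₃ hlt₃.le]
    refine payoff_le_of_winning (payoff_nonneg _ _ _) fun w₁ w₂ => ?_
    have := hM t ht (by linarith)
    linarith

/-- A winning deviation lies in `M` and overlaps `x₂` no less than `x₃` does. If it met the leader's
interval in positive mass, matching the leader would force `A x₁ = A x₂` and `u₂ = u₁ / 2`. -/
lemma stable_right_far (h : Leader A B L u₁ u₂ x₁) (h₁₂ : x₁ < x₂) (h₂₃ : x₂ ≤ x₃)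
    (hL₂ : x₂ ∈ L)
    (e₂ : mass A B x₂ - overlap A B x₁ x₂ / 2 = u₂)
    (e₃ : mass A B x₃ - overlap A B x₁ x₃ / 2 = u₂)
    (hM : ∀ z ∈ L, mass A B z - overlap A B x₁ z / 2 = u₂ → x₂ ≤ z ∧ z ≤ x₃) :
    Stable A B L x₃ x₁ x₂ := by
  intro t ht
  have hm₁ := h.mass_eq
  have hm₂ := h.mass_le x₂ hL₂
  have hmt := h.mass_le t ht
  have hgt := h.second_le t ht
  have hhalf := h.half_lt
  have hab := overlap_le_left (A := A) h.monoB h₁₂.le h₂₃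
  have hcb := overlap_le_right (B := B) h.monoA h₁₂.le h₂₃
  rw [gain_right h₁₂.le h₂₃]
  rcases le_or_gt t x₁ with hle | hlt
  · rw [gain_left hle h₁₂.le]
    refine payoff_le_of_winning (payoff_nonneg _ _ _) fun w₁ w₂ => ?_
    rw [overlap_comm A B x₁ t] at hgt
    have := hM t ht (by rw [overlap_comm A B x₁ t]; linarith)
    linarith
  rcases lt_or_ge t x₂ with hlt₂ | hge
  · rw [gain_middle hlt.le hlt₂.le]
    refine payoff_le_of_winning (payoff_nonneg _ _ _) fun w₁ w₂ => ?_
    have := hM t ht (by linarith)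
    linarith
  · rw [gain_right h₁₂.le hge]
    refine payoff_le_of_winning (payoff_nonneg _ _ _) fun w₁ w₂ => ?_
    have k₀ := overlap_le_left (A := A) h.monoB h₁₂.le hge
    have k₁ := overlap_le_right (B := B) h.monoA h₁₂.le hge
    have ht₃ := (hM t ht (by linarith)).2
    have k₂ := overlap_le_left (A := A) h.monoB hge ht₃
    have k₃ := overlap_nonneg A B x₁ x₃
    rcases (overlap_nonneg A B x₁ t).eq_or_lt with hb | hb
    · exact (payoff_le_third (by linarith) (by linarith)).trans
        (third_le_payoff (by linarith) (by linarith))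
    · exfalso
      have k₁ := overlap_of_pos hlt.le hb
      have k₂ := overlap_of_pos h₁₂.le (by linarith)
      have k₃ := overlap_of_pos hge (by linarith)
      simp only [mass] at *
      linarith

end Leader

/-! ### Symmetry between left and right -/

section Reflection

variable (A B : ℝ → ℝ) (L : Set ℝ)

/-- Reversing the line exchanges the ends of each interval, hence `A` and `B`; the outer sign keeps
both monotone. -/
lemma mass_reflect (x : ℝ) :
    mass (fun t => -B (-t)) (fun t => -A (-t)) x = mass A B (-x) := by
  simp only [mass]; ring

lemma overlap_reflect (x y : ℝ) :
    overlap (fun t => -B (-t)) (fun t => -A (-t)) x y = overlap A B (-x) (-y) := by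
  simp only [overlap, min_neg_neg, max_neg_neg]
  congr 1; ring

lemma overlap₃_reflect (x y z : ℝ) :
    overlap₃ (fun t => -B (-t)) (fun t => -A (-t)) x y z = overlap₃ A B (-x) (-y) (-z) := by
  simp only [overlap₃, min_neg_neg, max_neg_neg]
  congr 1; ring

lemma gain_reflect (x y z : ℝ) :
    gain (fun t => -B (-t)) (fun t => -A (-t)) x y z = gain A B (-x) (-y) (-z) := by
  simp only [gain, share, mass_reflect, overlap_reflect, overlap₃_reflect]

variable {A B L}

lemma Stable.of_reflect {x y z : ℝ}
    (h : Stable (fun t => -B (-t)) (fun t => -A (-t)) (-L) (-x) (-y) (-z)) :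
    Stable A B L x y z := by
  intro t ht
  simpa [gain_reflect] using h (-t) (by simpa using ht)

lemma Leader.reflect {u₁ u₂ x₁ : ℝ} (h : Leader A B L u₁ u₂ x₁) :
    Leader (fun t => -B (-t)) (fun t => -A (-t)) (-L) u₁ u₂ (-x₁) where
  monoA _ _ hab := neg_le_neg (h.monoB (neg_le_neg hab))
  monoB _ _ hab := neg_le_neg (h.monoA (neg_le_neg hab))
  le t := neg_le_neg (h.le (-t))
  mass_le z hz := by simpa [mass_reflect] using h.mass_le (-z) hz
  mass_eq := by simpa [mass_reflect] using h.mass_eq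
  second_le z hz := by simpa [mass_reflect, overlap_reflect] using h.second_le (-z) hz
  half_lt := h.half_lt

end Reflection

/-! ### From integrals and utilities to masses and overlaps -/

section Bridge

/-- The distribution function of `f` shifted by `s`. -/
def cdfShift (f : ℝ → ℝ) (s t : ℝ) : ℝ := ∫ y in Set.Iic (t + s), f y

variable {f : ℝ → ℝ} {w : ℝ}

/-- The positive part covers the empty interval `b < a`, that is, disjoint attraction intervals. -/
lemma setIntegral_Icc_eq (hf : IsClientDensity f) (a b : ℝ) :
    ∫ y in Set.Icc a b, f y = max 0 ((∫ y in Set.Iic b, f y) - ∫ y in Set.Iic a, f y) := by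
  have hmono : Monotone fun t => ∫ y in Set.Iic t, f y := fun s t hst =>
    setIntegral_mono_set hf.integrable.integrableOn
      (Filter.Eventually.of_forall hf.nonneg) (Set.Iic_subset_Iic.2 hst).eventuallyLE
  rcases le_total a b with hab | hab
  · rw [max_eq_right (sub_nonneg.2 (hmono hab)), intervalIntegral.integral_Iic_sub_Iic
      hf.integrable.integrableOn hf.integrable.integrableOn,
      intervalIntegral.integral_of_le hab, integral_Icc_eq_integral_Ioc]
  · rw [max_eq_left (sub_nonpos.2 (hmono hab)), integral_Icc_eq_integral_Ioc,
      Set.Ioc_eq_empty hab.not_gt, setIntegral_empty]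

lemma cdfShift_mono (hf : IsClientDensity f) (s : ℝ) : Monotone (cdfShift f s) := fun _ _ hab =>
  setIntegral_mono_set hf.integrable.integrableOn
    (Filter.Eventually.of_forall hf.nonneg)
    (Set.Iic_subset_Iic.2 (add_le_add_left hab s)).eventuallyLE

lemma cdfShift_le (hf : IsClientDensity f) (hw : 0 ≤ w) (t : ℝ) :
    cdfShift f (-(w / 2)) t ≤ cdfShift f (w / 2) t :=
  setIntegral_mono_set hf.integrable.integrableOn
    (Filter.Eventually.of_forall hf.nonneg)
    (Set.Iic_subset_Iic.2 (by linarith)).eventuallyLE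

lemma cdfShift_continuous (hf : IsClientDensity f) (s : ℝ) : Continuous (cdfShift f s) := by
  have h : cdfShift f s = fun t => (∫ y in (0 : ℝ)..(t + s), f y) + ∫ y in Set.Iic 0, f y := by
    funext t
    rw [← intervalIntegral.integral_Iic_sub_Iic hf.integrable.integrableOn
      hf.integrable.integrableOn, cdfShift]
    ring
  rw [h]
  exact ((intervalIntegral.continuous_primitive (fun _ _ => hf.integrable.intervalIntegrable)
    0).comp (continuous_id.add continuous_const)).add continuous_const

variable (f w) in
/-- The mass of the clients to the left of the right end of the interval at `t`. -/
abbrev upper : ℝ → ℝ := cdfShift f (w / 2)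

variable (f w) in
/-- The mass of the clients to the left of the left end of the interval at `t`. -/
abbrev lower : ℝ → ℝ := cdfShift f (-(w / 2))

lemma integral_attraction (hf : IsClientDensity f) (hw : 0 ≤ w) (z : ℝ) :
    ∫ y in attractionInterval w z, f y = mass (upper f w) (lower f w) z := by
  rw [attractionInterval, setIntegral_Icc_eq hf, max_eq_right]
  · simp [mass, cdfShift, sub_eq_add_neg]
  · simpa [cdfShift, sub_eq_add_neg] using cdfShift_le hf hw z

lemma integral_attraction_inter (hf : IsClientDensity f) (x y : ℝ) :
    ∫ t in attractionInterval w x ∩ attractionInterval w y, f t =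
      overlap (upper f w) (lower f w) x y := by
  rw [attractionInterval, attractionInterval, Set.Icc_inter_Icc, setIntegral_Icc_eq hf]
  simp only [overlap, cdfShift, ← sub_eq_add_neg, max_sub_sub_right, min_add_add_right]

lemma integral_attraction_inter₃ (hf : IsClientDensity f) (x y z : ℝ) :
    ∫ t in attractionInterval w x ∩ (attractionInterval w y ∩ attractionInterval w z), f t =
      overlap₃ (upper f w) (lower f w) x y z := by
  simp only [attractionInterval]
  rw [Set.Icc_inter_Icc, Set.Icc_inter_Icc, setIntegral_Icc_eq hf]
  simp only [overlap₃, cdfShift, ← sub_eq_add_neg, max_sub_sub_right, min_add_add_right]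

open Classical in
lemma integral_attraction_div_two (hf : IsClientDensity f) (hw : 0 ≤ w) (x y : ℝ) :
    ∫ t in attractionInterval w x, f t / (1 + if t ∈ attractionInterval w y then 1 else 0) =
      mass (upper f w) (lower f w) x - overlap (upper f w) (lower f w) x y / 2 := by
  have hm (z : ℝ) : MeasurableSet (attractionInterval w z) := measurableSet_Icc
  have h : ∀ t, f t / (1 + if t ∈ attractionInterval w y then 1 else 0) =
      f t - (attractionInterval w y).indicator f t / 2 := by
    intro t
    by_cases ht : t ∈ attractionInterval w y
    · simp [ht]; ring
    · simp [ht]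
  simp only [h]
  rw [integral_sub hf.integrable.integrableOn
    ((hf.integrable.indicator (hm y)).div_const 2).integrableOn, integral_div,
    setIntegral_indicator (hm y), integral_attraction hf hw, integral_attraction_inter hf]

open Classical in
lemma integral_attraction_div_three (hf : IsClientDensity f) (hw : 0 ≤ w) (x y z : ℝ) :
    ∫ t in attractionInterval w x, f t / (1 + (if t ∈ attractionInterval w y then 1 else 0) +
        if t ∈ attractionInterval w z then 1 else 0) =
      share (upper f w) (lower f w) x y z := by
  have hm (z : ℝ) : MeasurableSet (attractionInterval w z) := measurableSet_Icc
  have hi := hf.integrable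
  -- For `p, q ∈ {0, 1}`, `1 / (1 + p + q) = 1 - p / 2 - q / 2 + p * q / 3`.
  have h : ∀ t, f t / (1 + (if t ∈ attractionInterval w y then 1 else 0) +
        if t ∈ attractionInterval w z then 1 else 0) =
      f t - (attractionInterval w y).indicator f t / 2 -
        (attractionInterval w z).indicator f t / 2 +
        (attractionInterval w y ∩ attractionInterval w z).indicator f t / 3 := by
    intro t
    by_cases ht : t ∈ attractionInterval w y <;> by_cases ht' : t ∈ attractionInterval w z <;>
      simp [ht, ht'] <;> ring
  have i₁ := ((hi.indicator (hm y)).div_const 2).integrableOn (s := attractionInterval w x)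
  have i₂ := ((hi.indicator (hm z)).div_const 2).integrableOn (s := attractionInterval w x)
  have i₃ := ((hi.indicator ((hm y).inter (hm z))).div_const 3).integrableOn
    (s := attractionInterval w x)
  have i₄ : IntegrableOn (fun t => f t - (attractionInterval w y).indicator f t / 2)
    (attractionInterval w x) := hi.integrableOn.sub i₁
  have i₅ : IntegrableOn (fun t => f t - (attractionInterval w y).indicator f t / 2 -
    (attractionInterval w z).indicator f t / 2) (attractionInterval w x) := i₄.sub i₂
  simp only [h]
  rw [integral_add i₅ i₃, integral_sub i₄ i₂, integral_sub hi.integrableOn i₁,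
    integral_div, integral_div, integral_div,
    setIntegral_indicator (hm y), setIntegral_indicator (hm z),
    setIntegral_indicator ((hm y).inter (hm z)), integral_attraction hf hw,
    integral_attraction_inter hf, integral_attraction_inter hf, integral_attraction_inter₃ hf,
    share]

lemma newSupport_nil (hf : IsClientDensity f) (hw : 0 ≤ w) (x : Fin 0 → ℝ) (z : ℝ) :
    newSupport f w x z = mass (upper f w) (lower f w) z := by
  simp [newSupport, congestion, integral_attraction hf hw]

lemma newSupport_singleton (hf : IsClientDensity f) (hw : 0 ≤ w) (x z : ℝ) :
    newSupport f w ![x] z =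
      mass (upper f w) (lower f w) z - overlap (upper f w) (lower f w) x z / 2 := by
  classical
  rw [overlap_comm, ← integral_attraction_div_two hf hw, newSupport]
  refine setIntegral_congr_fun measurableSet_Icc fun t _ => ?_
  simp only [congestion, Finset.card_filter, Finset.sum_const, Finset.univ_unique,
    Finset.card_singleton, Matrix.cons_val_fin_one, one_smul]
  push_cast
  rw [add_comm]

lemma support_two (hf : IsClientDensity f) (hw : 0 ≤ w) (z : Fin 2 → ℝ) (i : Fin 2) :
    support f (fun _ => w) z i = mass (upper f w) (lower f w) (z i) -
      overlap (upper f w) (lower f w) (z 0) (z 1) / 2 := by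
  classical
  have h : ∀ i j : Fin 2, (∀ t, ∑ k, (if t ∈ attractionInterval w (z k) then 1 else 0 : ℝ) =
      (if t ∈ attractionInterval w (z i) then 1 else 0) +
        if t ∈ attractionInterval w (z j) then 1 else 0) →
      support f (fun _ => w) z i = mass (upper f w) (lower f w) (z i) -
        overlap (upper f w) (lower f w) (z i) (z j) / 2 := by
    intro i j hij
    rw [← integral_attraction_div_two hf hw, support]
    refine setIntegral_congr_fun measurableSet_Icc fun t ht => ?_
    have ht' : t ∈ attractionInterval w (z i) := ht
    simp only [congestion, Finset.card_filter]
    push_cast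
    rw [hij, if_pos ht']
  fin_cases i
  · exact h 0 1 fun t => by rw [Fin.sum_univ_two]
  · rw [overlap_comm]
    exact h 1 0 fun t => by rw [Fin.sum_univ_two, add_comm]

lemma support_three (hf : IsClientDensity f) (hw : 0 ≤ w) (x : Fin 3 → ℝ) {i j k : Fin 3}
    (hij : i ≠ j) (hik : i ≠ k) (hjk : j ≠ k) :
    support f (fun _ => w) x i = share (upper f w) (lower f w) (x i) (x j) (x k) := by
  classical
  have huniv : (Finset.univ : Finset (Fin 3)) = {i, j, k} := by
    revert hij hik hjk; revert i j k; decide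
  rw [← integral_attraction_div_three hf hw, support]
  refine setIntegral_congr_fun measurableSet_Icc fun t ht => ?_
  have ht' : t ∈ attractionInterval w (x i) := ht
  simp only [congestion, Finset.card_filter, huniv]
  rw [Finset.sum_insert (by simp [hij, hik]), Finset.sum_insert (by simp [hjk]),
    Finset.sum_singleton, if_pos ht']
  push_cast
  rw [add_assoc]

lemma winnerUtility_three (hf : IsClientDensity f) (hw : 0 ≤ w) (x : Fin 3 → ℝ) {i j k : Fin 3}
    (hij : i ≠ j) (hik : i ≠ k) (hjk : j ≠ k) :
    winnerUtility f (fun _ => w) x i = gain (upper f w) (lower f w) (x i) (x j) (x k) := by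
  classical
  have huniv : (Finset.univ : Finset (Fin 3)) = {i, j, k} := by
    revert hij hik hjk; revert i j k; decide
  have hall (p : Fin 3 → Prop) : (∀ l, p l) ↔ p i ∧ p j ∧ p k := by
    have : (∀ l, p l) ↔ ∀ l ∈ ({i, j, k} : Finset (Fin 3)), p l := by simp [← huniv]
    simpa using this
  rw [gain, ← support_three hf hw x hij hik hjk, ← support_three hf hw x hij.symm hjk hik,
    ← support_three hf hw x hik.symm hjk.symm hij]
  simp only [winnerUtility, winners, Finset.mem_filter, hall,
    Finset.card_filter, huniv]
  rw [Finset.sum_insert (by simp [hij, hik]), Finset.sum_insert (by simp [hjk]),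
    Finset.sum_singleton]
  generalize support f (fun _ => w) x i = p
  generalize support f (fun _ => w) x j = q
  generalize support f (fun _ => w) x k = r
  rcases lt_trichotomy p q with h | h | h
  · simp [payoff, h]
  · rcases lt_trichotomy p r with h' | h' | h'
    · simp [payoff, h']
    · subst h h'; norm_num [payoff]
    · subst h; norm_num [payoff, h'.le, h'.ne', h'.not_ge]
  · rcases lt_trichotomy p r with h' | h' | h'
    · simp [payoff, h']
    · subst h'; norm_num [payoff, h.le, h.ne', h.not_ge]
    · norm_num [payoff, h.le, h.ne', h.not_ge, h'.le, h'.ne', h'.not_ge]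

lemma isPureNash_of_stable (hf : IsClientDensity f) (hw : 0 ≤ w) {x : Fin 3 → ℝ}
    (hL : ∀ i, x i ∈ locations w)
    (h₀ : Stable (upper f w) (lower f w) (locations w) (x 0) (x 1) (x 2))
    (h₁ : Stable (upper f w) (lower f w) (locations w) (x 1) (x 0) (x 2))
    (h₂ : Stable (upper f w) (lower f w) (locations w) (x 2) (x 0) (x 1)) :
    IsPureNash (fun _ => locations w) (winnerUtility f (fun _ => w)) x := by
  refine ⟨hL, fun i t ht => ?_⟩
  have key : ∀ {i j k : Fin 3}, i ≠ j → i ≠ k → j ≠ k →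
      Stable (upper f w) (lower f w) (locations w) (x i) (x j) (x k) →
      winnerUtility f (fun _ => w) (Function.update x i t) i ≤
        winnerUtility f (fun _ => w) x i := by
    intro i j k hij hik hjk h
    rw [winnerUtility_three hf hw _ hij hik hjk, winnerUtility_three hf hw _ hij hik hjk]
    simpa [hij.symm, hik.symm] using h t ht
  fin_cases i
  · exact key (by decide) (by decide) (by decide) h₀
  · exact key (by decide) (by decide) (by decide) h₁
  · exact key (by decide) (by decide) (by decide) h₂

end Bridge

/-! ### Existence of an output and the five cases -/

section Algorithm

variable {f : ℝ → ℝ} {w : ℝ}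

lemma continuous_mass (hf : IsClientDensity f) : Continuous (mass (upper f w) (lower f w)) :=
  (cdfShift_continuous hf _).sub (cdfShift_continuous hf _)

lemma continuous_overlap (hf : IsClientDensity f) (x : ℝ) :
    Continuous (overlap (upper f w) (lower f w) x) :=
  continuous_const.max (((cdfShift_continuous hf _).comp (continuous_const.min continuous_id)).sub
    ((cdfShift_continuous hf _).comp (continuous_const.max continuous_id)))

lemma locations_nonempty (hw₁ : w ≤ 1) : (locations w).Nonempty :=
  Set.nonempty_Icc.2 (by linarith)

lemma exists_isLargestSupport (hw₁ : w ≤ 1) {k : ℕ} (x : Fin k → ℝ)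
    (hc : Continuous (newSupport f w x)) : ∃ u, IsLargestSupport f w x u :=
  (isCompact_Icc.image hc).exists_isGreatest ((locations_nonempty hw₁).image _)

lemma IsLargestSupport.achieving_nonempty {k : ℕ} {x : Fin k → ℝ} {u : ℝ}
    (hu : IsLargestSupport f w x u) : (achieving f w x u).Nonempty := by
  obtain ⟨z, hz, rfl⟩ := hu.1
  exact ⟨z, hz, rfl⟩

lemma IsLargestSupport.newSupport_le {k : ℕ} {x : Fin k → ℝ} {u z : ℝ}
    (hu : IsLargestSupport f w x u) (hz : z ∈ locations w) : newSupport f w x z ≤ u :=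
  hu.2 ⟨z, hz, rfl⟩

lemma isCompact_achieving {k : ℕ} {x : Fin k → ℝ} (hc : Continuous (newSupport f w x)) (u : ℝ) :
    IsCompact (achieving f w x u) :=
  isCompact_Icc.inter_right (isClosed_eq hc continuous_const)

lemma continuous_newSupport_nil (hf : IsClientDensity f) (hw₀ : 0 ≤ w) :
    Continuous (newSupport f w ![]) :=
  (continuous_mass hf).congr fun z => (newSupport_nil hf hw₀ _ z).symm

lemma continuous_newSupport_singleton (hf : IsClientDensity f) (hw₀ : 0 ≤ w) (x : ℝ) :
    Continuous (newSupport f w ![x]) :=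
  ((continuous_mass hf).sub ((continuous_overlap hf x).div_const 2)).congr fun z =>
    (newSupport_singleton hf hw₀ x z).symm

theorem exists_algorithm1 (hf : IsClientDensity f) (hw₀ : 0 ≤ w) (hw₁ : w ≤ 1) :
    ∃ x, Algorithm1 f w x := by
  have hc₀ := continuous_newSupport_nil hf hw₀
  obtain ⟨u₁, hu₁⟩ := exists_isLargestSupport hw₁ ![] hc₀
  by_cases h₃ : ∃ x : Fin 3 → ℝ, AllAchieve f w u₁ x
  · obtain ⟨x, hx⟩ := h₃
    exact ⟨x, .case1 u₁ x hu₁ hx⟩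
  by_cases h₂ : ∃ z : Fin 2 → ℝ, AllAchieve f w u₁ z
  · obtain ⟨z, hz⟩ := h₂
    exact ⟨_, .case2 u₁ z hu₁ h₃ hz⟩
  obtain ⟨x₁, hx₁⟩ := (isCompact_achieving hc₀ u₁).exists_isLeast hu₁.achieving_nonempty
  have hc := continuous_newSupport_singleton hf hw₀ x₁
  obtain ⟨u₂, hu₂⟩ := exists_isLargestSupport hw₁ ![x₁] hc
  have hp : FirstPlacement f w x₁ u₂ := ⟨⟨u₁, hu₁, h₃, h₂, hx₁⟩, hu₂⟩
  have hM := isCompact_achieving hc u₂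
  by_cases hmem : x₁ ∈ achieving f w ![x₁] u₂
  · exact ⟨_, .case3 x₁ u₂ hp hmem⟩
  by_cases hside : (∃ z ∈ achieving f w ![x₁] u₂, z < x₁) ∧ ∃ z ∈ achieving f w ![x₁] u₂, x₁ < z
  · obtain ⟨⟨a, ha, hax⟩, b, hb, hxb⟩ := hside
    -- As `x₁ ∉ M`, the strict inequality may be relaxed, which makes both sides of `M` compact.
    have hl : {z | z ∈ achieving f w ![x₁] u₂ ∧ z < x₁} =
        achieving f w ![x₁] u₂ ∩ Set.Iic x₁ := by
      ext z
      exact ⟨fun h => ⟨h.1, h.2.le⟩, fun h => ⟨h.1, h.2.lt_of_ne fun k => hmem (k ▸ h.1)⟩⟩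
    have hr : {z | z ∈ achieving f w ![x₁] u₂ ∧ x₁ < z} =
        achieving f w ![x₁] u₂ ∩ Set.Ici x₁ := by
      ext z
      exact ⟨fun h => ⟨h.1, h.2.le⟩, fun h => ⟨h.1, h.2.lt_of_ne fun k => hmem (k ▸ h.1)⟩⟩
    obtain ⟨x₂, hx₂⟩ := (hl ▸ hM.inter_right isClosed_Iic).exists_isGreatest ⟨a, ha, hax⟩
    obtain ⟨x₃, hx₃⟩ := (hr ▸ hM.inter_right isClosed_Ici).exists_isLeast ⟨b, hb, hxb⟩
    exact ⟨_, .case4 x₁ u₂ x₂ x₃ hp hmem hx₂ hx₃⟩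
  · obtain ⟨t₂, ht₂⟩ := hM.exists_isLeast hu₂.achieving_nonempty
    obtain ⟨t₃, ht₃⟩ := hM.exists_isGreatest hu₂.achieving_nonempty
    exact ⟨_, .case5 x₁ u₂ t₂ t₃ hp hmem hside ht₂ ht₃⟩

lemma FirstPlacement.leader (hf : IsClientDensity f) (hw₀ : 0 ≤ w) {x₁ u₂ : ℝ}
    (h : FirstPlacement f w x₁ u₂) (hnot : x₁ ∉ achieving f w ![x₁] u₂) :
    ∃ u₁, Leader (upper f w) (lower f w) (locations w) u₁ u₂ x₁ ∧ x₁ ∈ locations w ∧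
      ∀ z ∈ locations w, mass (upper f w) (lower f w) z = u₁ → x₁ ≤ z := by
  obtain ⟨⟨u₁, hu₁, -, -, hx₁⟩, hu₂⟩ := h
  have hmass : mass (upper f w) (lower f w) x₁ = u₁ := by
    rw [← newSupport_nil hf hw₀ ![]]; exact hx₁.1.2
  refine ⟨u₁, ⟨cdfShift_mono hf _, cdfShift_mono hf _, cdfShift_le hf hw₀, fun z hz => ?_, hmass,
    fun z hz => ?_, ?_⟩, hx₁.1.1, fun z hz k => ?_⟩
  · rw [← newSupport_nil hf hw₀ ![]]; exact hu₁.newSupport_le hz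
  · rw [← newSupport_singleton hf hw₀]; exact hu₂.newSupport_le hz
  -- A second agent at `x₁` itself would get `u₁ / 2`, which is not optimal by `hnot`.
  · have hlt : newSupport f w ![x₁] x₁ < u₂ :=
      (hu₂.newSupport_le hx₁.1.1).lt_of_ne fun k => hnot ⟨hx₁.1.1, k⟩
    rw [newSupport_singleton hf hw₀, overlap_self (cdfShift_le hf hw₀), hmass] at hlt
    linarith
  · exact hx₁.2 ⟨hz, by rw [newSupport_nil hf hw₀, k]⟩

lemma isPureNash_case1 (hf : IsClientDensity f) (hw₀ : 0 ≤ w) {u₁ : ℝ} {x : Fin 3 → ℝ}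
    (hu : IsLargestSupport f w ![] u₁) (hx : AllAchieve f w u₁ x) :
    IsPureNash (fun _ => locations w) (winnerUtility f (fun _ => w)) x := by
  have hA := cdfShift_mono hf (w / 2)
  have hB := cdfShift_mono hf (-(w / 2))
  have hL : ∀ z ∈ locations w, mass (upper f w) (lower f w) z ≤ u₁ := fun z hz => by
    rw [← newSupport_nil hf hw₀ ![]]; exact hu.newSupport_le hz
  have hs : ∀ {i j k : Fin 3}, i ≠ j → i ≠ k → j ≠ k →
      Stable (upper f w) (lower f w) (locations w) (x i) (x j) (x k) := fun {i j k} hij hik hjk =>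
    stable_of_disjoint hA hB hL
      ((support_three hf hw₀ x hij hik hjk).symm.trans (hx i).2)
      ((support_three hf hw₀ x hij.symm hjk hik).symm.trans (hx j).2)
      ((support_three hf hw₀ x hik.symm hjk.symm hij).symm.trans (hx k).2)
      (hL _ (hx j).1) (hL _ (hx k).1)
  exact isPureNash_of_stable hf hw₀ (fun i => (hx i).1) (hs (by decide) (by decide) (by decide))
    (hs (by decide) (by decide) (by decide)) (hs (by decide) (by decide) (by decide))

lemma isPureNash_case2 (hf : IsClientDensity f) (hw₀ : 0 ≤ w) {u₁ : ℝ} {z : Fin 2 → ℝ}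
    (hu : IsLargestSupport f w ![] u₁) (hthree : ¬ ∃ x : Fin 3 → ℝ, AllAchieve f w u₁ x)
    (hz : AllAchieve f w u₁ z) :
    IsPureNash (fun _ => locations w) (winnerUtility f (fun _ => w)) ![z 0, z 1, z 1] := by
  have hA := cdfShift_mono hf (w / 2)
  have hB := cdfShift_mono hf (-(w / 2))
  have hAB := cdfShift_le hf hw₀
  have hL : ∀ z ∈ locations w, mass (upper f w) (lower f w) z ≤ u₁ := fun z hz => by
    rw [← newSupport_nil hf hw₀ ![]]; exact hu.newSupport_le hz
  have h₀ := (hz 0).2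
  have h₁ := (hz 1).2
  rw [support_two hf hw₀] at h₀ h₁
  have hov := overlap_nonneg (upper f w) (lower f w) (z 0) (z 1)
  have hm₀ := hL _ (hz 0).1
  have hm₁ := hL _ (hz 1).1
  have e₀ : mass (upper f w) (lower f w) (z 0) = u₁ := by linarith
  have e₁ : mass (upper f w) (lower f w) (z 1) = u₁ := by linarith
  have e : overlap (upper f w) (lower f w) (z 0) (z 1) = 0 := by linarith
  have hno : ∀ t ∈ locations w, ¬ (mass (upper f w) (lower f w) t = u₁ ∧
      overlap (upper f w) (lower f w) t (z 0) = 0 ∧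
      overlap (upper f w) (lower f w) t (z 1) = 0) := by
    rintro t ht ⟨et, et₀, et₁⟩
    refine hthree ⟨![t, z 0, z 1], fun i => ?_⟩
    have k := overlap₃_nonneg (upper f w) (lower f w) t (z 0) (z 1)
    have k' := (overlap₃_le hA hB t (z 0) (z 1)).1
    have k₃ : overlap₃ (upper f w) (lower f w) t (z 0) (z 1) = 0 := by linarith
    have k₄ : overlap₃ (upper f w) (lower f w) (z 0) t (z 1) = 0 := by rw [overlap₃_rotate, k₃]
    have k₅ : overlap₃ (upper f w) (lower f w) (z 1) t (z 0) = 0 := by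
      have := overlap₃_nonneg (upper f w) (lower f w) (z 1) t (z 0)
      have := (overlap₃_le hA hB (z 1) t (z 0)).2.2
      linarith
    fin_cases i
    · refine ⟨ht, (support_three hf hw₀ _ (i := 0) (j := 1) (k := 2)
        (by decide) (by decide) (by decide)).trans ?_⟩
      simp [share, et, et₀, et₁, k₃]
    · refine ⟨(hz 0).1, (support_three hf hw₀ _ (i := 1) (j := 0) (k := 2)
        (by decide) (by decide) (by decide)).trans ?_⟩
      simp [share, overlap_comm _ _ (z 0) t, e₀, et₀, e, k₄]
    · refine ⟨(hz 1).1, (support_three hf hw₀ _ (i := 2) (j := 0) (k := 1)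
        (by decide) (by decide) (by decide)).trans ?_⟩
      simp [share, overlap_comm _ _ (z 1) _, e₁, et₁, e, k₅]
  -- If `u₁ = 0`, a third agent placed at `z 0` would have null overlaps and achieve `u₁`, so Case 1
  -- would apply.
  have hu₀ : 0 < u₁ := by
    refine lt_of_le_of_ne ?_ fun k => hno (z 0) (hz 0).1 ⟨e₀, ?_, e⟩
    · rw [← e₀]; exact sub_nonneg.2 (hAB _)
    · rw [overlap_self hAB, e₀, k]
  have hp := stable_of_pair hA hB hL e₀ e₁ e hno
  exact isPureNash_of_stable hf hw₀
    (by intro i; fin_cases i; exacts [(hz 0).1, (hz 1).1, (hz 1).1])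
    (stable_of_sole hAB hu₀ e₀ e₁ e) hp hp

lemma isPureNash_case3 (hf : IsClientDensity f) (hw₀ : 0 ≤ w) {x₁ u₂ : ℝ}
    (h : FirstPlacement f w x₁ u₂) (hmem : x₁ ∈ achieving f w ![x₁] u₂) :
    IsPureNash (fun _ => locations w) (winnerUtility f (fun _ => w)) ![x₁, x₁, x₁] := by
  have hAB := cdfShift_le hf hw₀
  have hs : Stable (upper f w) (lower f w) (locations w) x₁ x₁ x₁ := by
    refine stable_of_common hAB fun t ht => ?_
    have h₁ := hmem.2
    have h₂ := h.largest.newSupport_le ht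
    rw [newSupport_singleton hf hw₀] at h₁ h₂
    rw [overlap_self hAB] at h₁
    linarith
  exact isPureNash_of_stable hf hw₀
    (by intro i; fin_cases i <;> exact hmem.1) hs hs hs

lemma isPureNash_case4 (hf : IsClientDensity f) (hw₀ : 0 ≤ w) {x₁ u₂ x₂ x₃ : ℝ}
    (h : FirstPlacement f w x₁ u₂) (hnot : x₁ ∉ achieving f w ![x₁] u₂)
    (h₂ : IsGreatest {z | z ∈ achieving f w ![x₁] u₂ ∧ z < x₁} x₂)
    (h₃ : IsLeast {z | z ∈ achieving f w ![x₁] u₂ ∧ x₁ < z} x₃) :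
    IsPureNash (fun _ => locations w) (winnerUtility f (fun _ => w)) ![x₁, x₂, x₃] := by
  obtain ⟨u₁, hl, hx₁, hleft⟩ := h.leader hf hw₀ hnot
  have hg := newSupport_singleton hf hw₀ x₁
  have e₂ := h₂.1.1.2
  have e₃ := h₃.1.1.2
  rw [hg] at e₂ e₃
  have max₂ : ∀ z ∈ locations w, x₂ < z → z ≤ x₁ → mass (upper f w) (lower f w) z -
      overlap (upper f w) (lower f w) x₁ z / 2 < u₂ := by
    intro z hz hlt hle
    refine (hl.second_le z hz).lt_of_ne fun k => ?_
    have hm : z ∈ achieving f w ![x₁] u₂ := ⟨hz, by rw [hg, k]⟩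
    exact hlt.not_ge (h₂.2 ⟨hm, hle.lt_of_ne fun k' => hnot (k' ▸ hm)⟩)
  have min₃ : ∀ z ∈ locations w, x₁ ≤ z → z < x₃ → mass (upper f w) (lower f w) z -
      overlap (upper f w) (lower f w) x₁ z / 2 < u₂ := by
    intro z hz hle hlt
    refine (hl.second_le z hz).lt_of_ne fun k => ?_
    have hm : z ∈ achieving f w ![x₁] u₂ := ⟨hz, by rw [hg, k]⟩
    exact hlt.not_ge (h₃.2 ⟨hm, hle.lt_of_ne fun k' => hnot (k' ▸ hm)⟩)
  have hL₂ := h₂.1.1.1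
  have hL₃ := h₃.1.1.1
  refine isPureNash_of_stable hf hw₀ (by intro i; fin_cases i; exacts [hx₁, hL₂, hL₃])
    (hl.stable_inner h₂.1.2 h₃.1.2 hL₂ hL₃ e₂ e₃ max₂ min₃ hleft)
    (hl.stable_outer h₂.1.2 h₃.1.2 hL₃ e₂ e₃ max₂ min₃)
    -- After reflection `-x₃` is the left follower and `-x₂` the right one.
    (Stable.of_reflect (hl.reflect.stable_outer (neg_lt_neg h₃.1.2) (neg_lt_neg h₂.1.2)
      (by simpa using hL₂) ?_ ?_ (fun z hz k₁ k₂ => ?_) (fun z hz k₁ k₂ => ?_)))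
  · simpa [mass_reflect, overlap_reflect] using e₃
  · simpa [mass_reflect, overlap_reflect] using e₂
  · simpa [mass_reflect, overlap_reflect] using
      min₃ (-z) hz (le_neg_of_le_neg k₂) (neg_lt.1 k₁)
  · simpa [mass_reflect, overlap_reflect] using
      max₂ (-z) hz (lt_neg_of_lt_neg k₂) (neg_le.1 k₁)

lemma isPureNash_case5 (hf : IsClientDensity f) (hw₀ : 0 ≤ w) {x₁ u₂ t₂ t₃ : ℝ}
    (h : FirstPlacement f w x₁ u₂) (hnot : x₁ ∉ achieving f w ![x₁] u₂)
    (hside : ¬ ((∃ z ∈ achieving f w ![x₁] u₂, z < x₁) ∧ ∃ z ∈ achieving f w ![x₁] u₂, x₁ < z))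
    (h₂ : IsLeast (achieving f w ![x₁] u₂) t₂) (h₃ : IsGreatest (achieving f w ![x₁] u₂) t₃) :
    IsPureNash (fun _ => locations w) (winnerUtility f (fun _ => w))
      (if t₂ < x₁ then ![x₁, t₃, t₂] else ![x₁, t₂, t₃]) := by
  obtain ⟨u₁, hl, hx₁, hleft⟩ := h.leader hf hw₀ hnot
  have hg := newSupport_singleton hf hw₀ x₁
  have e₂ := h₂.1.2
  have e₃ := h₃.1.2
  rw [hg] at e₂ e₃
  have h₂₃ : t₂ ≤ t₃ := h₂.2 h₃.1
  have hL₂ := h₂.1.1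
  have hL₃ := h₃.1.1
  have hM : ∀ z ∈ locations w, mass (upper f w) (lower f w) z -
      overlap (upper f w) (lower f w) x₁ z / 2 = u₂ → t₂ ≤ z ∧ z ≤ t₃ := fun z hz k =>
    have hm : z ∈ achieving f w ![x₁] u₂ := ⟨hz, by rw [hg, k]⟩
    ⟨h₂.2 hm, h₃.2 hm⟩
  have hne : ∀ z ∈ achieving f w ![x₁] u₂, z ≠ x₁ := fun z hz k => hnot (k ▸ hz)
  split_ifs with hlt
  · have h₃₁ : t₃ < x₁ :=
      (not_lt.1 fun k => hside ⟨⟨t₂, h₂.1, hlt⟩, t₃, h₃.1, k⟩).lt_of_ne (hne _ h₃.1)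
    have hl' := hl.reflect
    have e₂' : mass (fun t => -lower f w (-t)) (fun t => -upper f w (-t)) (-t₂) -
        overlap (fun t => -lower f w (-t)) (fun t => -upper f w (-t)) (-x₁) (-t₂) / 2 = u₂ := by
      simpa [mass_reflect, overlap_reflect] using e₂
    have e₃' : mass (fun t => -lower f w (-t)) (fun t => -upper f w (-t)) (-t₃) -
        overlap (fun t => -lower f w (-t)) (fun t => -upper f w (-t)) (-x₁) (-t₃) / 2 = u₂ := by
      simpa [mass_reflect, overlap_reflect] using e₃
    have hM' : ∀ z ∈ -locations w, mass (fun t => -lower f w (-t)) (fun t => -upper f w (-t)) z -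
        overlap (fun t => -lower f w (-t)) (fun t => -upper f w (-t)) (-x₁) z / 2 = u₂ →
        -t₃ ≤ z ∧ z ≤ -t₂ := fun z hz k => by
      have := hM (-z) hz (by simpa [mass_reflect, overlap_reflect] using k)
      exact ⟨by linarith, by linarith⟩
    have hL₃' : -t₃ ∈ -locations w := by simpa using hL₃
    refine isPureNash_of_stable hf hw₀ (by intro i; fin_cases i; exacts [hx₁, hL₃, hL₂])
      (Stable.of_reflect (hl'.stable_right_leader (neg_lt_neg h₃₁) (neg_le_neg h₂₃) hL₃' e₃' e₂'
        fun k => ?_))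
      (Stable.of_reflect
        (hl'.stable_right_near (neg_lt_neg h₃₁) (neg_le_neg h₂₃) hL₃' e₃' e₂' hM'))
      (Stable.of_reflect
        (hl'.stable_right_far (neg_lt_neg h₃₁) (neg_le_neg h₂₃) hL₃' e₃' e₂' hM'))
    -- Left of `x₁` no location has mass `u₁`, so the tie condition of `stable_right_leader` is
    -- void.
    exact absurd (hleft t₃ hL₃ (by simpa [mass_reflect] using k)) h₃₁.not_ge
  · have h₁₂ : x₁ < t₂ := (not_lt.1 hlt).lt_of_ne' (hne _ h₂.1)
    exact isPureNash_of_stable hf hw₀ (by intro i; fin_cases i; exacts [hx₁, hL₂, hL₃])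
      (hl.stable_right_leader h₁₂ h₂₃ hL₂ e₂ e₃ fun _ => hleft)
      (hl.stable_right_near h₁₂ h₂₃ hL₂ e₂ e₃ hM)
      (hl.stable_right_far h₁₂ h₂₃ hL₂ e₂ e₃ hM)

end Algorithm

end HotellingDowns

end

theorem mainTheorem5 (f : ℝ → ℝ) (hf : HotellingDowns.IsClientDensity f)
    (w : ℝ) (hw₀ : 0 ≤ w) (hw₁ : w ≤ 1) :
    (∃ x : Fin 3 → ℝ, HotellingDowns.Algorithm1 f w x) ∧
      ∀ x : Fin 3 → ℝ, HotellingDowns.Algorithm1 f w x →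
        HotellingDowns.IsPureNash (fun _ => HotellingDowns.locations w)
          (HotellingDowns.winnerUtility f (fun _ => w)) x := by
  refine ⟨HotellingDowns.exists_algorithm1 hf hw₀ hw₁, fun x hx => ?_⟩
  cases hx with
  | case1 u₁ x hu hx => exact HotellingDowns.isPureNash_case1 hf hw₀ hu hx
  | case2 u₁ z hu hthree hz => exact HotellingDowns.isPureNash_case2 hf hw₀ hu hthree hz
  | case3 x₁ u₂ h hmem => exact HotellingDowns.isPureNash_case3 hf hw₀ h hmem
  | case4 x₁ u₂ x₂ x₃ h hnot h₂ h₃ => exact HotellingDowns.isPureNash_case4 hf hw₀ h hnot h₂ h₃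
  | case5 x₁ u₂ t₂ t₃ h hnot hside h₂ h₃ =>
    exact HotellingDowns.isPureNash_case5 hf hw₀ h hnot hside h₂ h₃
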